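/- For $n\ge 1$ and $(x,z)\in\{0,1\}^n\times\{0,1\}^n$ let $P_{(x,z)}=\bigotimes_{j=1}^n i^{x_jz_j}X^{x_j}Z^{z_j}$ be the Pauli strings on $n$ qubits. Every matrix $C\in\mathbb{R}^{2^n\times 2^n}$ has a unique Pauli expansion $C=\sum_{(x,z)} c_{(x,z)}P_{(x,z)}$ with $c_{(x,z)}\in\mathbb{C}$ (real if $C$ is symmetric); put $\|C\|_{P,\ell_1}=\sum_{(x,z)}|c_{(x,z)}|$, call the number of nonzero coefficients the number of Pauli terms of $C$, and let $\|\cdot\|$ be the operator norm. Theorem. There is a universal constant $K>0$ such that for all $n\ge 1$, all $C\in\mathbb{R}^{2^n\times 2^n}$ and all $\epsilon>0$, the following hold. 1. There is a matrix $\tilde C\in\mathbb{R}^{2^n\times 2^n}$ with at most $K\,n\,\|C\|_{P,\ell_1}^2\,\epsilon^{-2}$ Pauli terms such that $\|C-\tilde C\|\le\epsilon$. 2. Suppose $C\ne 0$ and let $m\ge\lfloor K\,n\,\|C\|_{P,\ell_1}^2\,\epsilon^{-2}\rfloor$ be a natural number. Let $P_1,\dots,P_m$ be independent samples from the distribution on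 Pauli strings $p(x,z)=|c_{(x,z)}|/\|C\|_{P,\ell_1}$, and set $$\tilde C=\frac1m\sum_{k=1}^m \|C\|_{P,\ell_1}\,\operatorname{sign}(c_{P_k})\,P_k ,\qquad \operatorname{sign}(c)=c/|c|$$ (with $\tilde C=0$ if $m=0$). Then with probability at least $2/3$, $\tilde C$ is a real matrix with at most $m$ Pauli terms and $\|C-\tilde C\|\le\epsilon$. In particular $m=\lfloor K\,n\,\|C\|_{P,\ell_1}^2\,\epsilon^{-2}\rfloor=O(n\|C\|_{P,\ell_1}^2\epsilon^{-2})$ samples suffice. -/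

import Mathlib

open MeasureTheory ProbabilityTheory
open scoped Matrix.Norms.L2Operator

namespace PauliSparsification

/-- Labels `r ∈ {0,1}ⁿ` of the `2ⁿ` computational basis vectors of `n` qubits.  A `2ⁿ × 2ⁿ` matrix
is a matrix whose rows and columns are indexed by `Qubits n`. -/
abbrev Qubits (n : ℕ) : Type := Fin n → Fin 2

/-- Labels `(x, z) ∈ {0,1}ⁿ × {0,1}ⁿ` of the `4ⁿ` Pauli strings on `n` qubits. -/
abbrev PauliIndex (n : ℕ) : Type := (Fin n → Fin 2) × (Fin n → Fin 2)

/-- The Pauli matrix `X`. -/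
def pauliX : Matrix (Fin 2) (Fin 2) ℂ := !![0, 1; 1, 0]

/-- The Pauli matrix `Z`. -/
def pauliZ : Matrix (Fin 2) (Fin 2) ℂ := !![1, 0; 0, -1]

/-- The single-qubit Pauli matrix `i^{xz} X^x Z^z`, that is `I`, `X`, `Z`, `Y` for
`(x, z) = (0,0), (1,0), (0,1), (1,1)`. -/
noncomputable def pauliOne (x z : Fin 2) : Matrix (Fin 2) (Fin 2) ℂ :=
  Complex.I ^ ((x : ℕ) * (z : ℕ)) • (pauliX ^ (x : ℕ) * pauliZ ^ (z : ℕ))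

/-- The Pauli string `P_{(x,z)} = ⨂ⱼ i^{xⱼ zⱼ} Xⱼ^{xⱼ} Zⱼ^{zⱼ}`; the `(r, s)` entry of a tensor
product of `2 × 2` matrices is the product of their `(rⱼ, sⱼ)` entries. -/
noncomputable def pauliString {n : ℕ} (p : PauliIndex n) : Matrix (Qubits n) (Qubits n) ℂ :=
  Matrix.of fun r s => ∏ j, pauliOne (p.1 j) (p.2 j) (r j) (s j)

/-- The coefficient `c_P = 2⁻ⁿ tr (P C)` of the Pauli string `P` in the Pauli expansion of the real
matrix `C`.  See `eq_sum_pauliCoeff` and `pauliCoeff_unique`: these are exactly the coefficients of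
the unique expansion `C = ∑ c_P P`. -/
noncomputable def pauliCoeff {n : ℕ} (C : Matrix (Qubits n) (Qubits n) ℝ) (p : PauliIndex n) : ℂ :=
  (pauliString p * C.map Complex.ofReal).trace / 2 ^ n

/-- The Pauli `ℓ₁` norm `‖C‖_{P,ℓ₁} = ∑ |c_P|`. -/
noncomputable def pauliL1 {n : ℕ} (C : Matrix (Qubits n) (Qubits n) ℝ) : ℝ :=
  ∑ p, ‖pauliCoeff C p‖

open Classical in
/-- The number of Pauli terms of `C`: the number of nonzero coefficients in its Pauli expansion. -/
noncomputable def pauliTerms {n : ℕ} (C : Matrix (Qubits n) (Qubits n) ℝ) : ℕ :=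
  (Finset.univ.filter fun p => pauliCoeff C p ≠ 0).card

/-- The value `‖C‖_{P,ℓ₁} sign(c_P) P` attached to the sample `P`; here `sign(c) = c / |c|`, which
is `±1` when `c` is real. -/
noncomputable def sampleMatrix {n : ℕ} (C : Matrix (Qubits n) (Qubits n) ℝ) (p : PauliIndex n) :
    Matrix (Qubits n) (Qubits n) ℂ :=
  ((pauliL1 C : ℂ) * (pauliCoeff C p / (‖pauliCoeff C p‖ : ℂ))) • pauliString p

/-- The empirical mean `m⁻¹ ∑ₖ ‖C‖_{P,ℓ₁} sign(c_{Pₖ}) Pₖ` of the samples `P₁, …, P_m`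
(the zero matrix if `m = 0`). -/
noncomputable def sampleMean {n : ℕ} (C : Matrix (Qubits n) (Qubits n) ℝ) {m : ℕ}
    (s : Fin m → PauliIndex n) : Matrix (Qubits n) (Qubits n) ℂ :=
  (m : ℂ)⁻¹ • ∑ k, sampleMatrix C (s k)

theorem pauliOne_complete (r s a b : Fin 2) :
    ∑ q : Fin 2 × Fin 2, pauliOne q.1 q.2 r s * pauliOne q.1 q.2 a b =
      if r = b ∧ s = a then 2 else 0 := by
  rw [Fintype.sum_prod_type]
  fin_cases r <;> fin_cases s <;> fin_cases a <;> fin_cases b <;>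
    simp [pauliOne, pauliX, pauliZ, Fin.sum_univ_two] <;> norm_num

theorem pauliOne_orthogonal (q t : Fin 2 × Fin 2) :
    ∑ r : Fin 2, ∑ s : Fin 2, pauliOne q.1 q.2 r s * pauliOne t.1 t.2 s r =
      if q = t then 2 else 0 := by
  obtain ⟨x, z⟩ := q
  obtain ⟨x', z'⟩ := t
  fin_cases x <;> fin_cases z <;> fin_cases x' <;> fin_cases z' <;>
    simp [pauliOne, pauliX, pauliZ, Fin.sum_univ_two] <;> norm_num

theorem pauliString_complete {n : ℕ} (r s a b : Qubits n) :
    ∑ p : PauliIndex n, pauliString p r s * pauliString p a b =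
      if r = b ∧ s = a then 2 ^ n else 0 := by
  have h : ∑ p : PauliIndex n, pauliString p r s * pauliString p a b =
      ∑ f : Fin n → Fin 2 × Fin 2, ∏ j, (pauliOne (f j).1 (f j).2 (r j) (s j) *
        pauliOne (f j).1 (f j).2 (a j) (b j)) := by
    refine (Fintype.sum_equiv (Equiv.arrowProdEquivProdArrow (Fin n) (fun _ => Fin 2)
      (fun _ => Fin 2)) _ _ fun f => ?_).symm
    simp [pauliString, Finset.prod_mul_distrib, Equiv.arrowProdEquivProdArrow]
  have e := Fintype.prod_sum (fun (j : Fin n) (q : Fin 2 × Fin 2) =>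
    pauliOne q.1 q.2 (r j) (s j) * pauliOne q.1 q.2 (a j) (b j))
  refine (h.trans e.symm).trans ?_
  simp only [pauliOne_complete]
  split_ifs with hc
  · obtain ⟨rfl, rfl⟩ := hc
    simp
  · have : ∃ j, ¬ (r j = b j ∧ s j = a j) := by
      by_contra! hcon
      exact hc ⟨funext fun j => (hcon j).1, funext fun j => (hcon j).2⟩
    obtain ⟨j, hj⟩ := this
    exact Finset.prod_eq_zero (Finset.mem_univ j) (if_neg hj)

theorem pauliString_orthogonal {n : ℕ} (p q : PauliIndex n) :
    (pauliString p * pauliString q).trace = if p = q then 2 ^ n else 0 := by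
  have h : (pauliString p * pauliString q).trace = ∏ j, ∑ r : Fin 2, ∑ s : Fin 2,
      pauliOne (p.1 j) (p.2 j) r s * pauliOne (q.1 j) (q.2 j) s r := by
    simp only [Fintype.prod_sum]
    simp [Matrix.trace, Matrix.mul_apply, pauliString, Finset.prod_mul_distrib]
  rw [h]
  have h2 := fun j => pauliOne_orthogonal (p.1 j, p.2 j) (q.1 j, q.2 j)
  simp only at h2
  simp only [h2]
  split_ifs with hc
  · subst hc
    simp
  · have : ∃ j, ¬ ((p.1 j, p.2 j) = (q.1 j, q.2 j)) := by
      by_contra! hcon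
      simp only [Prod.mk.injEq] at hcon
      exact hc (Prod.ext (funext fun j => (hcon j).1) (funext fun j => (hcon j).2))
    obtain ⟨j, hj⟩ := this
    exact Finset.prod_eq_zero (Finset.mem_univ j) (if_neg hj)

/-- Every real `2ⁿ × 2ⁿ` matrix has the Pauli expansion `C = ∑ c_P P`. -/
theorem eq_sum_pauliCoeff {n : ℕ} (C : Matrix (Qubits n) (Qubits n) ℝ) :
    C.map Complex.ofReal = ∑ p, pauliCoeff C p • pauliString p := by
  ext a b
  have h : ∀ p : PauliIndex n, pauliCoeff C p * pauliString p a b =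
      ∑ r, ∑ s, ((C s r : ℂ) / 2 ^ n) * (pauliString p r s * pauliString p a b) := by
    intro p
    simp only [pauliCoeff, Matrix.trace, Matrix.diag_apply, Matrix.mul_apply, Matrix.map_apply,
      Finset.sum_div, Finset.sum_mul]
    refine Finset.sum_congr rfl fun r _ => Finset.sum_congr rfl fun s _ => ?_
    ring
  simp only [Matrix.sum_apply, Matrix.smul_apply, smul_eq_mul, h, Matrix.map_apply]
  rw [Finset.sum_comm]
  simp only [Finset.sum_comm (s := (Finset.univ : Finset (PauliIndex n))), ← Finset.mul_sum,
    pauliString_complete]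
  simp [ite_and]

/-- The coefficients of the Pauli expansion are unique. -/
theorem pauliCoeff_unique {n : ℕ} (C : Matrix (Qubits n) (Qubits n) ℝ) (c : PauliIndex n → ℂ)
    (hc : C.map Complex.ofReal = ∑ p, c p • pauliString p) : c = pauliCoeff C := by
  funext q
  simp [pauliCoeff, hc, Matrix.mul_sum, Matrix.trace_sum, pauliString_orthogonal]

end PauliSparsification

/-!
The idea is to bound the expected operator norm of the error `C̃ - C` by `10 ‖C‖_{P,ℓ₁} √(n / m)` and
to apply Markov's inequality; everything is a finite sum, weighted by the product weight of a tuple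
of samples. The first assertion follows from the second, since good tuples exist.

*Noncommutative Khintchine inequality* (`sum_norm_pow_le`). For contractions `B_k` and independent
random signs `e_k` put `S = ∑ e_k B_k`. Expanding `(S S*)^{2N}` into words and averaging over the
signs, each word has norm at most `1` and its sign average is nonnegative, so
`‖E (S S*)^{2N}‖ ≤ E (∑ e_k)^{4N}` (`norm_sum_sign_smul_mul_prod_le`).  As `‖S‖^{4N}` is at most the
trace of `(S S*)^{2N}`, it follows that `E ‖S‖^{4N} ≤ d · E (∑ e_k)^{4N}` in dimension `d`. The
scalar moment is bounded through the moment generating function `cosh(t)^m`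
(`sum_sum_sign_pow_le`). For `d = 2ⁿ` the choice `N = n` absorbs the dimensional factor into a
constant, and `E ‖S‖ ≤ 5 √(n m)` (`sum_norm_sign_smul_le`). This replaces a matrix Chernoff bound.

*Symmetrization* (`sum_prod_weight_mul_norm_sub_le`). An independent copy of the samples and random
signs bound the expected distance of a sum from its mean by twice the expected norm of the signed
sum.

*Pauli strings.* They are unitary (`norm_pauliString`), so every sample has norm at most
`‖C‖_{P,ℓ₁}`. Entrywise conjugation multiplies both `P` and, `C` being real, `c_P` by the same sign,
so `c_P P` is a real matrix and hence so is the sample mean (`exists_map_ofReal_eq_sampleMean`).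
-/

namespace PauliSparsification

/-! ### Noncommutative Khintchine inequality -/

/-- Monomials in independent random signs have nonnegative mean: the mean factors, and each factor is
`0` or `1` according to the parity of the exponent. -/
theorem sum_prod_sign_pow_nonneg {κ : Type*} [Fintype κ] [DecidableEq κ] (a : κ → ℕ) :
    0 ≤ ∑ e : κ → ℤˣ, ∏ k, (((e k : ℤˣ) : ℤ) : ℝ) ^ a k := by
  have h := Fintype.prod_sum (fun (k : κ) (u : ℤˣ) => (((u : ℤˣ) : ℤ) : ℝ) ^ a k)
  rw [← h]
  refine Finset.prod_nonneg fun k _ => ?_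
  rw [show (Finset.univ : Finset ℤˣ) = {1, -1} from rfl, Finset.sum_pair (by decide)]
  rcases Nat.even_or_odd (a k) with h | h <;> simp [h.neg_one_pow]

theorem prod_sign_pow_add_single {κ : Type*} [Fintype κ] [DecidableEq κ] (a : κ → ℕ) (e : κ → ℤˣ)
    (j : κ) : ∏ k, (((e k : ℤˣ) : ℤ) : ℝ) ^ (a + Pi.single j 1 : κ → ℕ) k =
      (∏ k, (((e k : ℤˣ) : ℤ) : ℝ) ^ a k) * (((e j : ℤˣ) : ℤ) : ℝ) := by
  simp only [Pi.add_apply, pow_add, Finset.prod_mul_distrib]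
  congr 1
  rw [Finset.prod_eq_single j] <;> simp +contextual

theorem sum_prod_sign_pow_mul_pow_succ {κ : Type*} [Fintype κ] [DecidableEq κ] (a : κ → ℕ)
    (N : ℕ) :
    ∑ e : κ → ℤˣ, (∏ k, (((e k : ℤˣ) : ℤ) : ℝ) ^ a k) *
        (∑ k, (((e k : ℤˣ) : ℤ) : ℝ)) ^ (N + 1) =
      ∑ j, ∑ e : κ → ℤˣ, (∏ k, (((e k : ℤˣ) : ℤ) : ℝ) ^ (a + Pi.single j 1 : κ → ℕ) k) *
        (∑ k, (((e k : ℤˣ) : ℤ) : ℝ)) ^ N := by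
  rw [Finset.sum_comm]
  refine Finset.sum_congr rfl fun e _ => ?_
  simp only [prod_sign_pow_add_single, pow_succ', ← Finset.sum_mul, ← Finset.mul_sum]
  ring

theorem sum_prod_sign_pow_mul_pow_nonneg {κ : Type*} [Fintype κ] [DecidableEq κ] (a : κ → ℕ)
    (N : ℕ) : 0 ≤ ∑ e : κ → ℤˣ, (∏ k, (((e k : ℤˣ) : ℤ) : ℝ) ^ a k) *
      (∑ k, (((e k : ℤˣ) : ℤ) : ℝ)) ^ N := by
  induction N generalizing a with
  | zero => simpa using sum_prod_sign_pow_nonneg a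
  | succ N ih =>
    rw [sum_prod_sign_pow_mul_pow_succ]
    exact Finset.sum_nonneg fun j _ => ih _

/-- The sign average of a product of signed sums of contractions is dominated in norm by the same
average for scalars `1`. The monomial `∏ e_k ^ a_k` and the prefix `W` collect the factors already
expanded; expanding one more moves a sign into the monomial and a contraction into the prefix. -/
theorem norm_sum_sign_smul_mul_prod_le {κ : Type*} [Fintype κ] [DecidableEq κ] {A : Type*}
    [NormedRing A] [NormedAlgebra ℝ A] (l : List (κ → A)) (hl : ∀ B ∈ l, ∀ k, ‖B k‖ ≤ 1)
    (W : A) (a : κ → ℕ) :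
    ‖∑ e : κ → ℤˣ, (∏ k, (((e k : ℤˣ) : ℤ) : ℝ) ^ a k) •
        (W * (l.map fun B => ∑ k, (((e k : ℤˣ) : ℤ) : ℝ) • B k).prod)‖ ≤
      ‖W‖ * ∑ e : κ → ℤˣ, (∏ k, (((e k : ℤˣ) : ℤ) : ℝ) ^ a k) *
        (∑ k, (((e k : ℤˣ) : ℤ) : ℝ)) ^ l.length := by
  induction l generalizing W a with
  | nil =>
    simp only [List.map_nil, List.prod_nil, mul_one, List.length_nil, pow_zero]
    rw [← Finset.sum_smul, norm_smul, Real.norm_of_nonneg (sum_prod_sign_pow_nonneg a), mul_comm]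
  | cons B l ih =>
    have hB : ∀ k, ‖B k‖ ≤ 1 := hl B (by simp)
    have h1 : ∑ e : κ → ℤˣ, (∏ k, (((e k : ℤˣ) : ℤ) : ℝ) ^ a k) •
        (W * ((B :: l).map fun B => ∑ k, (((e k : ℤˣ) : ℤ) : ℝ) • B k).prod) =
        ∑ j, ∑ e : κ → ℤˣ, (∏ k, (((e k : ℤˣ) : ℤ) : ℝ) ^ (a + Pi.single j 1 : κ → ℕ) k) •
          ((W * B j) * (l.map fun B => ∑ k, (((e k : ℤˣ) : ℤ) : ℝ) • B k).prod) := by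
      rw [Finset.sum_comm]
      refine Finset.sum_congr rfl fun e _ => ?_
      simp only [prod_sign_pow_add_single, List.map_cons, List.prod_cons, mul_smul, ← Finset.smul_sum]
      congr 1
      rw [← mul_assoc, Finset.mul_sum, Finset.sum_mul]
      exact Finset.sum_congr rfl fun j _ => by simp [mul_assoc]
    rw [h1, List.length_cons, sum_prod_sign_pow_mul_pow_succ, Finset.mul_sum]
    refine (norm_sum_le _ _).trans (Finset.sum_le_sum fun j _ => ?_)
    have h3 := ih (fun B' h => hl B' (by simp [h])) (W * B j) (a + Pi.single j 1)
    have h4 : ‖W * B j‖ ≤ ‖W‖ :=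
      (norm_mul_le _ _).trans (mul_le_of_le_one_right (norm_nonneg _) (hB j))
    exact h3.trans (mul_le_mul_of_nonneg_right h4
      (sum_prod_sign_pow_mul_pow_nonneg _ _))

/-- The C⋆-identity gives equality for exponents `2 ^ k`; other exponents follow by splitting the
power `2 ^ N`, with `N < 2 ^ N`, into `x ^ N` and a remainder. -/
theorem norm_pow_le_norm_pow_of_isSelfAdjoint {A : Type*} [NormedRing A] [StarRing A] [CStarRing A]
    {x : A} (hx : IsSelfAdjoint x) (N : ℕ) (hN : N ≠ 0) : ‖x‖ ^ N ≤ ‖x ^ N‖ := by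
  rcases eq_or_ne x 0 with rfl | h0
  · simp [hN]
  have hlt : N < 2 ^ N := Nat.lt_two_pow_self
  obtain ⟨r, hr⟩ : ∃ r, 2 ^ N = N + (r + 1) := ⟨2 ^ N - N - 1, by omega⟩
  have h := hx.norm_pow_two_pow N
  have hpos : 0 < ‖x‖ ^ (r + 1) := by positivity
  refine le_of_mul_le_mul_right ?_ hpos
  rw [← pow_add, ← hr, ← h, hr, pow_add]
  exact (norm_mul_le _ _).trans (mul_le_mul_of_nonneg_left (norm_pow_le' _ (by omega)) (norm_nonneg _))

theorem norm_apply_le_l2_opNorm {ι : Type*} [Fintype ι] [DecidableEq ι] (A : Matrix ι ι ℂ) (i j : ι) :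
    ‖A i j‖ ≤ ‖A‖ := by
  have h := A.l2_opNorm_mulVec (WithLp.toLp 2 (Pi.single j (1 : ℂ)))
  have h2 := PiLp.norm_apply_le ((EuclideanSpace.equiv ι ℂ).symm
    (A.mulVec (WithLp.toLp 2 (Pi.single j (1 : ℂ))).ofLp)) i
  have h3 := h2.trans h
  simpa using h3

theorem norm_trace_le {ι : Type*} [Fintype ι] [DecidableEq ι] (A : Matrix ι ι ℂ) :
    ‖A.trace‖ ≤ Fintype.card ι * ‖A‖ := by
  refine (norm_sum_le _ _).trans ?_
  refine (Finset.sum_le_sum fun i _ => norm_apply_le_l2_opNorm A i i).trans ?_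
  simp

/-- The operator norm is at most the Hilbert–Schmidt norm. -/
theorem sq_l2_opNorm_le_trace {ι : Type*} [Fintype ι] [DecidableEq ι] (A : Matrix ι ι ℂ) :
    ‖A‖ ^ 2 ≤ (A * A.conjTranspose).trace.re := by
  have h : (A * A.conjTranspose).trace.re = ∑ i, ∑ j, ‖A i j‖ ^ 2 := by
    simp [Matrix.trace, Matrix.mul_apply, Complex.mul_conj, Complex.normSq_eq_norm_sq]
    norm_cast
  rw [h]
  have h0 : 0 ≤ ∑ i, ∑ j, ‖A i j‖ ^ 2 := by positivity
  rw [← Real.le_sqrt (norm_nonneg _) h0, ← Matrix.l2_opNorm_toEuclideanCLM]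
  refine ContinuousLinearMap.opNorm_le_bound _ (Real.sqrt_nonneg _) fun x => ?_
  rw [EuclideanSpace.norm_eq, EuclideanSpace.norm_eq x, ← Real.sqrt_mul h0]
  refine Real.sqrt_le_sqrt ?_
  rw [Finset.sum_mul]
  refine Finset.sum_le_sum fun i _ => ?_
  rw [Matrix.ofLp_toEuclideanCLM]
  refine le_trans ?_ (Finset.sum_mul_sq_le_sq_mul_sq Finset.univ (fun j => ‖A i j‖) fun j => ‖x j‖)
  gcongr
  refine (norm_sum_le _ _).trans (le_of_eq ?_)
  simp

/-- A noncommutative Khintchine inequality: the moments of a signed sum of contractions are at most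
the dimension times those of the scalar sum of signs. -/
theorem sum_norm_pow_le {ι κ : Type*} [Fintype ι] [DecidableEq ι] [Nonempty ι] [Fintype κ]
    [DecidableEq κ] (B : κ → Matrix ι ι ℂ) (hB : ∀ k, ‖B k‖ ≤ 1) (N : ℕ) (hN : N ≠ 0) :
    ∑ e : κ → ℤˣ, ‖∑ k, (((e k : ℤˣ) : ℤ) : ℝ) • B k‖ ^ (4 * N) ≤
      Fintype.card ι * ∑ e : κ → ℤˣ, (∑ k, (((e k : ℤˣ) : ℤ) : ℝ)) ^ (4 * N) := by
  set S : (κ → ℤˣ) → Matrix ι ι ℂ := fun e => ∑ k, (((e k : ℤˣ) : ℤ) : ℝ) • B k with hS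
  have h1 : ∀ e, ‖S e‖ ^ (4 * N) ≤ ((S e * star (S e)) ^ (2 * N)).trace.re := by
    intro e
    have hsa : IsSelfAdjoint (S e * star (S e)) := IsSelfAdjoint.mul_star_self _
    have h2 := sq_l2_opNorm_le_trace ((S e * star (S e)) ^ N)
    rw [← Matrix.star_eq_conjTranspose, (hsa.pow N).star_eq, ← pow_add, ← two_mul] at h2
    refine le_trans ?_ h2
    have h3 := norm_pow_le_norm_pow_of_isSelfAdjoint hsa N hN
    rw [CStarRing.norm_self_mul_star] at h3
    calc ‖S e‖ ^ (4 * N) = ((‖S e‖ * ‖S e‖) ^ N) ^ 2 := by ring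
      _ ≤ _ := by gcongr
  refine (Finset.sum_le_sum fun e _ => h1 e).trans ?_
  have h4 : ∑ e, ((S e * star (S e)) ^ (2 * N)).trace.re =
      (∑ e, (S e * star (S e)) ^ (2 * N)).trace.re := by
    rw [Matrix.trace_sum, Complex.re_sum]
  rw [h4]
  refine (Complex.re_le_norm _).trans ((norm_trace_le _).trans ?_)
  gcongr
  have h5 := norm_sum_sign_smul_mul_prod_le (List.replicate (2 * N) [B, star B]).flatten
    (by
      intro B' hB' k
      simp only [List.mem_flatten, List.mem_replicate] at hB'
      obtain ⟨l, ⟨-, rfl⟩, h⟩ := hB'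
      simp only [List.mem_cons, List.not_mem_nil, or_false] at h
      rcases h with rfl | rfl
      · exact hB k
      · simpa using hB k) (1 : Matrix ι ι ℂ) 0
  simp only [Pi.zero_apply, pow_zero, Finset.prod_const_one, one_smul, one_mul, norm_one] at h5
  have h6 : ∀ e : κ → ℤˣ, ((List.replicate (2 * N) [B, star B]).flatten.map
      fun B => ∑ k, (((e k : ℤˣ) : ℤ) : ℝ) • B k).prod = (S e * star (S e)) ^ (2 * N) := by
    intro e
    rw [List.map_flatten, List.map_replicate, List.prod_flatten, List.map_replicate,
      List.prod_replicate]
    simp [hS, star_sum]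
  have h7 : (List.replicate (2 * N) [B, star B]).flatten.length = 4 * N := by
    simp
    ring
  simp only [h6, h7] at h5
  exact h5

/-! ### Moments of a sum of random signs -/

theorem sum_exp_sum_sign {κ : Type*} [Fintype κ] [DecidableEq κ] (t : ℝ) :
    ∑ e : κ → ℤˣ, Real.exp (t * ∑ k, (((e k : ℤˣ) : ℤ) : ℝ)) =
      (2 * Real.cosh t) ^ Fintype.card κ := by
  have h := Fintype.prod_sum (fun (_ : κ) (u : ℤˣ) => Real.exp (t * (((u : ℤˣ) : ℤ) : ℝ)))
  simp only [Finset.mul_sum, Real.exp_sum]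
  rw [← h, Finset.prod_const, Finset.card_univ]
  congr 1
  rw [show (Finset.univ : Finset ℤˣ) = {1, -1} from rfl, Finset.sum_pair (by decide),
    Real.cosh_eq]
  simp
  ring

/-- Obtained from `y ^ (2N) / (2N)! ≤ exp |y|` at `y = t x` and `cosh t ≤ exp (t² / 2)`; the
parameter `t` is free. -/
theorem sum_sum_sign_pow_le {κ : Type*} [Fintype κ] [DecidableEq κ] (N : ℕ) {t : ℝ} (ht : 0 < t) :
    ∑ e : κ → ℤˣ, (∑ k, (((e k : ℤˣ) : ℤ) : ℝ)) ^ (2 * N) ≤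
      2 ^ Fintype.card κ *
        (2 * ((2 * N).factorial / t ^ (2 * N)) * Real.exp (t ^ 2 / 2 * Fintype.card κ)) := by
  have h1 : ∀ x : ℝ, x ^ (2 * N) ≤
      (2 * N).factorial / t ^ (2 * N) * (Real.exp (t * x) + Real.exp (-t * x)) := by
    intro x
    have h := Real.pow_div_factorial_le_exp (x := |t * x|) (abs_nonneg _) (2 * N)
    rw [Even.pow_abs (even_two_mul N), mul_pow, div_le_iff₀ (by positivity)] at h
    have h2 : Real.exp |t * x| ≤ Real.exp (t * x) + Real.exp (-t * x) := by
      rcases abs_cases (t * x) with ⟨h, -⟩ | ⟨h, -⟩ <;> rw [h]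
      · linarith [Real.exp_pos (-t * x)]
      · rw [neg_mul]; linarith [Real.exp_pos (t * x)]
    rw [div_mul_eq_mul_div, le_div_iff₀ (by positivity)]
    calc _ = _ := mul_comm _ _
      _ ≤ _ := h
      _ ≤ _ := by rw [mul_comm]; gcongr
  refine (Finset.sum_le_sum fun e _ => h1 _).trans ?_
  rw [← Finset.mul_sum, Finset.sum_add_distrib, sum_exp_sum_sign, sum_exp_sum_sign, Real.cosh_neg]
  have h3 : Real.cosh t ^ Fintype.card κ ≤ Real.exp (t ^ 2 / 2 * Fintype.card κ) := by
    rw [mul_comm, Real.exp_nat_mul]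
    gcongr
    exact Real.cosh_le_exp_half_sq t
  have h4 : (0 : ℝ) ≤ (2 * N).factorial / t ^ (2 * N) * 2 * 2 ^ Fintype.card κ := by positivity
  rw [mul_pow]
  nlinarith [mul_le_mul_of_nonneg_left h3 h4]

/-! ### Symmetrization -/

section
variable {κ α E : Type*} [Fintype κ] [DecidableEq κ] [Fintype α]
  [NormedAddCommGroup E] [NormedSpace ℝ E]

theorem sum_prod_weight {w : α → ℝ} (hw1 : ∑ a, w a = 1) : ∑ s : κ → α, ∏ k, w (s k) = 1 := by
  rw [← Fintype.prod_sum (fun (_ : κ) a => w a)]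
  simp [hw1]

/-- Each coordinate of a tuple with product weight has marginal weight `w`. -/
theorem sum_prod_weight_smul_apply {w : α → ℝ} (hw1 : ∑ a, w a = 1) (Y : α → E) (j : κ) :
    ∑ s : κ → α, (∏ k, w (s k)) • Y (s j) = ∑ a, w a • Y a := by
  classical
  have h1 : ∀ a, ∑ s : κ → α, (∏ k, w (s k)) * (if s j = a then 1 else 0) = w a := by
    intro a
    have h := Fintype.prod_sum (fun (k : κ) b => w b * (if k = j then if b = a then 1 else 0 else 1))
    rw [Finset.prod_eq_single j] at h
    · simp only [Finset.prod_mul_distrib, Finset.prod_ite_eq', Finset.mem_univ, if_true] at h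
      rw [← h]
      simp
    · intro k _ hk
      simp [hk, hw1]
    · simp
  have h2 : ∑ a, w a • Y a = ∑ a, ∑ s : κ → α, ((∏ k, w (s k)) * (if s j = a then 1 else 0)) • Y a :=
    Finset.sum_congr rfl fun a _ => by rw [← Finset.sum_smul, h1]
  rw [h2, Finset.sum_comm]
  simp [ite_smul]

/-- Symmetrization: a bound for all sign averages of sums of values of `Y` bounds the mean deviation
of a sum of independent samples of `Y` from its expectation. -/
theorem sum_prod_weight_mul_norm_sub_le {w : α → ℝ} (hw : ∀ a, 0 ≤ w a) (hw1 : ∑ a, w a = 1)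
    (Y : α → E) {b : ℝ}
    (hb : ∀ s : κ → α, ∑ e : κ → ℤˣ, ‖∑ k, (((e k : ℤˣ) : ℤ) : ℝ) • Y (s k)‖ ≤
      2 ^ Fintype.card κ * b) :
    ∑ s : κ → α, (∏ k, w (s k)) * ‖∑ k, Y (s k) - (Fintype.card κ : ℝ) • ∑ a, w a • Y a‖ ≤
      2 * b := by
  set W : (κ → α) → ℝ := fun s => ∏ k, w (s k) with hW
  have hW0 : ∀ s, 0 ≤ W s := fun s => Finset.prod_nonneg fun k _ => hw _
  have hW1 : ∑ s, W s = 1 := sum_prod_weight hw1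
  set F : ℝ := ∑ z : (κ → α) × (κ → α), W z.1 * W z.2 * ‖∑ k, (Y (z.1 k) - Y (z.2 k))‖ with hF
  -- Replacing the mean by an independent copy of the sample only increases the norm (Jensen).
  have hghost : ∑ s : κ → α, W s * ‖∑ k, Y (s k) - (Fintype.card κ : ℝ) • ∑ a, w a • Y a‖ ≤ F := by
    rw [hF, Fintype.sum_prod_type]
    refine Finset.sum_le_sum fun s _ => ?_
    simp only [mul_assoc, ← Finset.mul_sum]
    refine mul_le_mul_of_nonneg_left ?_ (hW0 s)
    have h : ∑ k, Y (s k) - (Fintype.card κ : ℝ) • ∑ a, w a • Y a =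
        ∑ s', W s' • ∑ k, (Y (s k) - Y (s' k)) := by
      simp only [Finset.sum_sub_distrib, smul_sub, ← Finset.sum_smul, hW1, one_smul]
      congr 1
      simp only [Finset.smul_sum]
      rw [Finset.sum_comm]
      have := fun j => sum_prod_weight_smul_apply (κ := κ) hw1 Y j
      simp only [hW, this]
      simp [Finset.smul_sum, Nat.cast_smul_eq_nsmul]
    rw [h]
    refine (norm_sum_le _ _).trans (le_of_eq (Finset.sum_congr rfl fun s' _ => ?_))
    rw [norm_smul, Real.norm_of_nonneg (hW0 s')]
  -- Exchanging the two copies where `e k = -1` preserves the weight, so signs may be inserted.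
  have hswap : ∀ e : κ → ℤˣ, F = ∑ z : (κ → α) × (κ → α), W z.1 * W z.2 *
      ‖∑ k, (((e k : ℤˣ) : ℤ) : ℝ) • (Y (z.1 k) - Y (z.2 k))‖ := by
    intro e
    let σ : (κ → α) × (κ → α) → (κ → α) × (κ → α) := fun z =>
      (fun k => if e k = 1 then z.1 k else z.2 k, fun k => if e k = 1 then z.2 k else z.1 k)
    have hσ : Function.Involutive σ := by
      intro z
      ext k <;> by_cases h : e k = 1 <;> simp [σ, h]
    refine Fintype.sum_equiv hσ.toPerm _ _ fun z => ?_
    simp only [Function.Involutive.coe_toPerm, σ, hW, ← Finset.prod_mul_distrib]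
    congr 1
    · refine Finset.prod_congr rfl fun k _ => ?_
      split_ifs
      · rfl
      · exact mul_comm _ _
    · congr 1
      refine Finset.sum_congr rfl fun k _ => ?_
      rcases Int.units_eq_one_or (e k) with h | h <;> simp [h]
  have hmarg : ∀ g : (κ → α) → ℝ,
      (∑ z : (κ → α) × (κ → α), W z.1 * W z.2 * g z.1 = ∑ s, W s * g s) ∧
      (∑ z : (κ → α) × (κ → α), W z.1 * W z.2 * g z.2 = ∑ s, W s * g s) := by
    intro g
    constructor
    · rw [Fintype.sum_prod_type]
      refine Finset.sum_congr rfl fun s _ => ?_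
      simp only [← Finset.sum_mul, ← Finset.mul_sum, hW1, mul_one]
    · rw [Fintype.sum_prod_type_right]
      refine Finset.sum_congr rfl fun s _ => ?_
      simp only [← Finset.sum_mul, hW1, one_mul]
  have hF2 : ∀ e : κ → ℤˣ, F ≤ 2 * ∑ s, W s * ‖∑ k, (((e k : ℤˣ) : ℤ) : ℝ) • Y (s k)‖ := by
    intro e
    obtain ⟨h1, h2⟩ := hmarg fun s => ‖∑ k, (((e k : ℤˣ) : ℤ) : ℝ) • Y (s k)‖
    rw [hswap e, two_mul]
    nth_rewrite 1 [← h1]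
    rw [← h2, ← Finset.sum_add_distrib]
    refine Finset.sum_le_sum fun z _ => ?_
    rw [← mul_add]
    refine mul_le_mul_of_nonneg_left ?_ (mul_nonneg (hW0 _) (hW0 _))
    simp only [smul_sub, Finset.sum_sub_distrib]
    exact norm_sub_le _ _
  have hcard : (Fintype.card (κ → ℤˣ) : ℝ) = 2 ^ Fintype.card κ := by
    simp [Fintype.card_units_int]
  have hsum : (2 : ℝ) ^ Fintype.card κ * F ≤ 2 ^ Fintype.card κ * (2 * b) := by
    calc (2 : ℝ) ^ Fintype.card κ * F = ∑ _e : κ → ℤˣ, F := by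
          rw [Finset.sum_const, Finset.card_univ, nsmul_eq_mul, hcard]
      _ ≤ ∑ e : κ → ℤˣ, 2 * ∑ s, W s * ‖∑ k, (((e k : ℤˣ) : ℤ) : ℝ) • Y (s k)‖ :=
          Finset.sum_le_sum fun e _ => hF2 e
      _ = 2 * ∑ s, W s * ∑ e : κ → ℤˣ, ‖∑ k, (((e k : ℤˣ) : ℤ) : ℝ) • Y (s k)‖ := by
          rw [← Finset.mul_sum, Finset.sum_comm]
          simp only [Finset.mul_sum]
      _ ≤ 2 * ∑ s, W s * (2 ^ Fintype.card κ * b) := by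
          gcongr with s
          · exact hW0 s
          · exact hb s
      _ = _ := by rw [← Finset.sum_mul, hW1]; ring
  exact hghost.trans (le_of_mul_le_mul_left hsum (by positivity))

end

/-! ### Signed sums in dimension `2ⁿ` -/

/-- The moment of order `4n` turns the dimension `2ⁿ` into a constant factor. -/
theorem sum_norm_sign_smul_le {n m : ℕ} (hn : 1 ≤ n) (hm : 1 ≤ m)
    (Y : Fin m → Matrix (Qubits n) (Qubits n) ℂ) {R : ℝ} (hR : 0 < R) (hY : ∀ k, ‖Y k‖ ≤ R) :
    ∑ e : Fin m → ℤˣ, ‖∑ k, (((e k : ℤˣ) : ℤ) : ℝ) • Y k‖ ≤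
      2 ^ m * (5 * Real.sqrt (n * m) * R) := by
  have hn0 : (0 : ℝ) < n := by exact_mod_cast hn
  have hm0 : (0 : ℝ) < m := by exact_mod_cast hm
  set B : Fin m → Matrix (Qubits n) (Qubits n) ℂ := fun k => R⁻¹ • Y k with hBdef
  have hB : ∀ k, ‖B k‖ ≤ 1 := by
    intro k
    rw [hBdef, norm_smul, Real.norm_of_nonneg (by positivity), inv_mul_le_one₀ hR]
    exact hY k
  set f : (Fin m → ℤˣ) → ℝ := fun e => ‖∑ k, (((e k : ℤˣ) : ℤ) : ℝ) • B k‖ with hf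
  have hYB : ∀ e : Fin m → ℤˣ, ‖∑ k, (((e k : ℤˣ) : ℤ) : ℝ) • Y k‖ = R * f e := by
    intro e
    have : ∑ k, (((e k : ℤˣ) : ℤ) : ℝ) • Y k = R • ∑ k, (((e k : ℤˣ) : ℤ) : ℝ) • B k := by
      rw [Finset.smul_sum]
      refine Finset.sum_congr rfl fun k _ => ?_
      rw [hBdef, smul_comm R, smul_inv_smul₀ hR.ne']
    rw [this, norm_smul, Real.norm_of_nonneg hR.le]
  have hcard : (Fintype.card (Fin m → ℤˣ) : ℝ) = 2 ^ m := by
    simp [Fintype.card_units_int]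
  have hpow : (∑ e, ((2 : ℝ) ^ m)⁻¹ * f e) ^ (4 * n) ≤ ∑ e, ((2 : ℝ) ^ m)⁻¹ * f e ^ (4 * n) := by
    refine Real.pow_arith_mean_le_arith_mean_pow _ _ _ (fun _ _ => by positivity) ?_
      (fun _ _ => norm_nonneg _) _
    rw [Finset.sum_const, Finset.card_univ, nsmul_eq_mul, hcard]
    exact mul_inv_cancel₀ (by positivity)
  have hk := sum_norm_pow_le B hB n (by omega)
  -- The value `t² = 4n / m` minimizes the bound `t ^ (-4n) * exp (t² m / 2)`.
  have hq : 0 < Real.sqrt (4 * n / m) := Real.sqrt_pos.2 (by positivity)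
  have hr := sum_sum_sign_pow_le (κ := Fin m) (2 * n) hq
  rw [Real.sq_sqrt (by positivity), Fintype.card_fin, show 2 * (2 * n) = 4 * n by ring] at hr
  have ht : Real.sqrt (4 * n / m) ^ (4 * n) = (4 * n / m) ^ (2 * n) := by
    rw [show 4 * n = 2 * (2 * n) by ring, pow_mul, Real.sq_sqrt (by positivity)]
  have hdim : (Fintype.card (Qubits n) : ℝ) = 2 ^ n := by simp
  have hfac : ((4 * n).factorial : ℝ) ≤ (4 * n) ^ (4 * n) := by
    exact_mod_cast Nat.factorial_le_pow (4 * n)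
  have hexp : Real.exp (4 * n / m / 2 * m) ≤ 2.72 ^ (2 * n) := by
    have : (4 * n / m / 2 * m : ℝ) = ((2 * n : ℕ) : ℝ) * 1 := by
      push_cast
      field_simp
      ring
    rw [this, Real.exp_nat_mul]
    gcongr
    exact (Real.exp_one_lt_d9.trans (by norm_num)).le
  have hfinal : (∑ e, ((2 : ℝ) ^ m)⁻¹ * f e) ^ (4 * n) ≤ (5 * Real.sqrt (n * m)) ^ (4 * n) := by
    refine hpow.trans ?_
    rw [← Finset.mul_sum, inv_mul_le_iff₀ (by positivity)]
    refine hk.trans ?_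
    rw [hdim]
    refine (mul_le_mul_of_nonneg_left hr (by positivity)).trans ?_
    rw [mul_left_comm]
    refine mul_le_mul_of_nonneg_left ?_ (by positivity)
    rw [ht]
    calc (2 : ℝ) ^ n * (2 * ((4 * n).factorial / (4 * n / m) ^ (2 * n)) *
          Real.exp (4 * n / m / 2 * m))
        ≤ 2 ^ n * (2 * ((4 * n) ^ (4 * n) / (4 * n / m) ^ (2 * n)) * 2.72 ^ (2 * n)) := by gcongr
      _ = 2 ^ (n + 1) * ((4 * n * m) ^ (2 * n) * 2.72 ^ (2 * n)) := by
          rw [show 4 * n = 2 * n + 2 * n by ring, pow_add (4 * (n : ℝ)), div_pow, mul_pow _ (m : ℝ)]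
          field_simp
          ring
      _ ≤ 2 ^ (2 * n) * ((4 * n * m) ^ (2 * n) * 2.72 ^ (2 * n)) := by
          gcongr
          · norm_num
          · omega
      _ = (21.76 * (n * m)) ^ (2 * n) := by
          rw [← mul_pow, ← mul_pow]
          ring_nf
      _ ≤ (25 * (n * m)) ^ (2 * n) := by
          gcongr
          norm_num
      _ = (5 * Real.sqrt (n * m)) ^ (4 * n) := by
          rw [show 4 * n = 2 * (2 * n) by ring, pow_mul (5 * Real.sqrt (n * m)), mul_pow 5,
            Real.sq_sqrt (by positivity)]
          norm_num
  have h := le_of_pow_le_pow_left₀ (by omega) (by positivity) hfinal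
  rw [← Finset.mul_sum, inv_mul_le_iff₀ (by positivity)] at h
  simp only [hYB, ← Finset.mul_sum]
  calc R * ∑ e, f e ≤ R * (2 ^ m * (5 * Real.sqrt (n * m))) := by gcongr
    _ = _ := by ring

/-! ### Pauli strings -/

theorem pauliOne_mul_star (x z r r' : Fin 2) :
    ∑ s : Fin 2, pauliOne x z r s * star (pauliOne x z r' s) = if r = r' then 1 else 0 := by
  fin_cases x <;> fin_cases z <;> fin_cases r <;> fin_cases r' <;>
    simp [pauliOne, pauliX, pauliZ, Fin.sum_univ_two]

theorem star_pauliOne (x z r s : Fin 2) :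
    star (pauliOne x z r s) = (-1) ^ ((x : ℕ) * (z : ℕ)) * pauliOne x z r s := by
  fin_cases x <;> fin_cases z <;> fin_cases r <;> fin_cases s <;>
    simp [pauliOne, pauliX, pauliZ]

theorem norm_pauliString {n : ℕ} (p : PauliIndex n) : ‖pauliString p‖ = 1 := by
  have h : pauliString p * star (pauliString p) = 1 := by
    ext r r'
    have h1 : ∀ s : Qubits n, pauliString p r s * star (pauliString p) s r' =
        ∏ j, (pauliOne (p.1 j) (p.2 j) (r j) (s j) *
          star (pauliOne (p.1 j) (p.2 j) (r' j) (s j))) := by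
      intro s
      simp [pauliString, Matrix.star_apply, Finset.prod_mul_distrib]
    rw [Matrix.mul_apply]
    simp only [h1]
    rw [← Fintype.prod_sum (fun j (s : Fin 2) => pauliOne (p.1 j) (p.2 j) (r j) s *
          star (pauliOne (p.1 j) (p.2 j) (r' j) s))]
    simp only [pauliOne_mul_star, Matrix.one_apply]
    split_ifs with hr
    · simp [hr]
    · obtain ⟨j, hj⟩ := Function.ne_iff.1 hr
      exact Finset.prod_eq_zero (Finset.mem_univ j) (if_neg hj)
  have h2 := CStarRing.norm_self_mul_star (x := pauliString p)
  rw [h, norm_one] at h2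
  nlinarith [norm_nonneg (pauliString p)]

/-- The matrix `c_P P` is real: conjugation multiplies the entries of `P`, and hence `c_P`, by
`∏ (-1)^{x_j z_j}`. -/
theorem star_pauliCoeff_mul_pauliString {n : ℕ} (C : Matrix (Qubits n) (Qubits n) ℝ)
    (p : PauliIndex n) (r s : Qubits n) :
    star (pauliCoeff C p * pauliString p r s) = pauliCoeff C p * pauliString p r s := by
  set u : ℂ := ∏ j, (-1 : ℂ) ^ ((p.1 j : ℕ) * (p.2 j : ℕ)) with hu
  have h1 : ∀ r s : Qubits n, star (pauliString p r s) = u * pauliString p r s := by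
    intro r s
    simp only [pauliString, Matrix.of_apply, star_prod, star_pauliOne, Finset.prod_mul_distrib, hu]
  have huu : u * u = 1 := by
    rw [hu, ← Finset.prod_mul_distrib]
    refine Finset.prod_eq_one fun j _ => ?_
    rw [← mul_pow]
    simp
  have h2 : star (pauliCoeff C p) = u * pauliCoeff C p := by
    simp only [Complex.star_def] at h1
    simp [pauliCoeff, Matrix.trace, Matrix.mul_apply, h1, Finset.mul_sum, Finset.sum_div,
      mul_assoc, mul_div_assoc]
  rw [star_mul, h1, h2]
  linear_combination (pauliCoeff C p * pauliString p r s) * huu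

theorem star_sampleMatrix_apply {n : ℕ} (C : Matrix (Qubits n) (Qubits n) ℝ)
    (p : PauliIndex n) (r s : Qubits n) :
    star (sampleMatrix C p r s) = sampleMatrix C p r s := by
  have h : sampleMatrix C p r s =
      ((pauliL1 C / ‖pauliCoeff C p‖ : ℝ) : ℂ) * (pauliCoeff C p * pauliString p r s) := by
    simp only [sampleMatrix, Matrix.smul_apply, smul_eq_mul]
    push_cast
    ring
  rw [h, star_mul', star_pauliCoeff_mul_pauliString]
  simp

theorem exists_map_ofReal_eq_sampleMean {n m : ℕ} (C : Matrix (Qubits n) (Qubits n) ℝ)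
    (s : Fin m → PauliIndex n) :
    ∃ Ct : Matrix (Qubits n) (Qubits n) ℝ, Ct.map Complex.ofReal = sampleMean C s := by
  refine ⟨(sampleMean C s).map Complex.re, ?_⟩
  ext a b
  simp only [Matrix.map_apply]
  refine Complex.conj_eq_iff_re.1 ?_
  have h := fun p => star_sampleMatrix_apply C p a b
  simp only [Complex.star_def] at h
  simp [sampleMean, Matrix.sum_apply, h]

theorem pauliTerms_le_of_map_eq_sampleMean {n m : ℕ} {C Ct : Matrix (Qubits n) (Qubits n) ℝ}
    {s : Fin m → PauliIndex n} (h : Ct.map Complex.ofReal = sampleMean C s) :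
    pauliTerms Ct ≤ m := by
  classical
  set c : PauliIndex n → ℂ := fun p => (m : ℂ)⁻¹ * ∑ k, if s k = p then
    (pauliL1 C : ℂ) * (pauliCoeff C (s k) / (‖pauliCoeff C (s k)‖ : ℂ)) else 0 with hc
  have h1 : Ct.map Complex.ofReal = ∑ p, c p • pauliString p := by
    rw [h]
    simp only [hc, mul_smul, ← Finset.smul_sum, Finset.sum_smul, sampleMean]
    rw [Finset.sum_comm]
    simp [sampleMatrix, ite_smul, mul_smul]
  have h2 := pauliCoeff_unique Ct c h1
  calc pauliTerms Ct ≤ (Finset.univ.image s).card := by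
        refine Finset.card_le_card fun p hp => ?_
        simp only [Finset.mem_filter, Finset.mem_univ, true_and, ← h2, hc] at hp
        simp only [Finset.mem_image, Finset.mem_univ, true_and]
        by_contra! hcon
        exact hp (by simp [hcon])
    _ ≤ m := by simpa using Finset.card_image_le (s := Finset.univ) (f := s)

theorem l2_opNorm_le_map_ofReal {ι : Type*} [Fintype ι] [DecidableEq ι] (A : Matrix ι ι ℝ) :
    ‖A‖ ≤ ‖A.map Complex.ofReal‖ := by
  rw [← Matrix.l2_opNorm_toEuclideanCLM]
  refine ContinuousLinearMap.opNorm_le_bound _ (norm_nonneg _) fun x => ?_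
  have h := (A.map Complex.ofReal).l2_opNorm_mulVec
    (WithLp.toLp 2 fun i => ((x i : ℝ) : ℂ))
  have h1 : ‖(WithLp.toLp 2 fun i => ((x i : ℝ) : ℂ) : EuclideanSpace ℂ ι)‖ = ‖x‖ := by
    simp [EuclideanSpace.norm_eq]
  rw [h1] at h
  refine le_trans (le_of_eq ?_) h
  rw [EuclideanSpace.norm_eq, EuclideanSpace.norm_eq]
  congr 1
  refine Finset.sum_congr rfl fun i _ => ?_
  rw [Matrix.ofLp_toEuclideanCLM, ← Complex.norm_real]
  simp [Matrix.mulVec, dotProduct]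

theorem pauliL1_pos {n : ℕ} {C : Matrix (Qubits n) (Qubits n) ℝ} (hC : C ≠ 0) : 0 < pauliL1 C := by
  refine lt_of_le_of_ne (Finset.sum_nonneg fun p _ => norm_nonneg _) fun h => hC ?_
  have h1 : ∀ p, pauliCoeff C p = 0 := by
    intro p
    have := (Finset.sum_eq_zero_iff_of_nonneg fun p _ => norm_nonneg (pauliCoeff C p)).1 h.symm p
      (Finset.mem_univ p)
    simpa using this
  have h2 := eq_sum_pauliCoeff C
  simp only [h1, zero_smul, Finset.sum_const_zero] at h2
  ext a b
  simpa using congr_fun (congr_fun h2 a) b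

theorem norm_map_ofReal_le_pauliL1 {n : ℕ} (C : Matrix (Qubits n) (Qubits n) ℝ) :
    ‖C.map Complex.ofReal‖ ≤ pauliL1 C := by
  rw [eq_sum_pauliCoeff C]
  refine (norm_sum_le _ _).trans (Finset.sum_le_sum fun p _ => ?_)
  rw [norm_smul, norm_pauliString, mul_one]

theorem norm_sampleMatrix_le {n : ℕ} (C : Matrix (Qubits n) (Qubits n) ℝ) (p : PauliIndex n) :
    ‖sampleMatrix C p‖ ≤ pauliL1 C := by
  have h0 : 0 ≤ pauliL1 C := Finset.sum_nonneg fun p _ => norm_nonneg _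
  rw [sampleMatrix, norm_smul, norm_pauliString, mul_one, norm_mul, norm_div, Complex.norm_real,
    Complex.norm_real, norm_norm, Real.norm_of_nonneg h0]
  exact mul_le_of_le_one_right h0 (div_self_le_one _)

theorem sum_weight_smul_sampleMatrix {n : ℕ} {C : Matrix (Qubits n) (Qubits n) ℝ}
    (hC : C ≠ 0) :
    ∑ p, (‖pauliCoeff C p‖ / pauliL1 C) • sampleMatrix C p = C.map Complex.ofReal := by
  rw [eq_sum_pauliCoeff C]
  refine Finset.sum_congr rfl fun p _ => ?_
  have hL : (pauliL1 C : ℂ) ≠ 0 := by exact_mod_cast (pauliL1_pos hC).ne'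
  rw [sampleMatrix, ← Complex.coe_smul, smul_smul]
  congr 1
  rcases eq_or_ne (pauliCoeff C p) 0 with h | h
  · simp [h]
  · have : ((‖pauliCoeff C p‖ : ℝ) : ℂ) ≠ 0 := by exact_mod_cast norm_ne_zero_iff.2 h
    push_cast
    field_simp

/-! ### Concentration of the sample mean -/

theorem sum_weight_mul_norm_sampleMean_sub_le {n m : ℕ} (hn : 1 ≤ n) (hm : 1 ≤ m)
    {C : Matrix (Qubits n) (Qubits n) ℝ} (hC : C ≠ 0) :
    m * ∑ s : Fin m → PauliIndex n, (∏ k, ‖pauliCoeff C (s k)‖ / pauliL1 C) *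
        ‖sampleMean C s - C.map Complex.ofReal‖ ≤
      10 * Real.sqrt (n * m) * pauliL1 C := by
  have hL := pauliL1_pos hC
  have hm0 : (0 : ℝ) < m := by exact_mod_cast hm
  have h := sum_prod_weight_mul_norm_sub_le (κ := Fin m)
    (w := fun p => ‖pauliCoeff C p‖ / pauliL1 C) (fun p => by positivity)
    (by rw [← Finset.sum_div]; exact div_self hL.ne') (sampleMatrix C)
    (b := 5 * Real.sqrt (n * m) * pauliL1 C) (fun s => by
      rw [Fintype.card_fin]
      exact sum_norm_sign_smul_le hn hm _ hL fun k => norm_sampleMatrix_le C (s k))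
  rw [sum_weight_smul_sampleMatrix hC, Fintype.card_fin] at h
  refine le_trans (le_of_eq ?_) (h.trans (le_of_eq (by ring)))
  rw [Finset.mul_sum]
  refine Finset.sum_congr rfl fun s _ => ?_
  rw [mul_left_comm]
  congr 1
  have h2 : ∑ k, sampleMatrix C (s k) - (m : ℝ) • C.map Complex.ofReal =
      (m : ℝ) • (sampleMean C s - C.map Complex.ofReal) := by
    have h3 : (m : ℂ)⁻¹ = (((m : ℝ)⁻¹ : ℝ) : ℂ) := by push_cast; rfl
    rw [smul_sub, sampleMean, h3, Complex.coe_smul, smul_inv_smul₀ hm0.ne']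
  rw [h2, norm_smul, Real.norm_of_nonneg hm0.le]

/-- Markov's inequality for the weighted sum over sample tuples: the tuples whose mean is within `ε`
of `C` carry at least two thirds of the total weight. -/
theorem two_thirds_le_sum_weight {n m : ℕ} (hn : 1 ≤ n)
    {C : Matrix (Qubits n) (Qubits n) ℝ} (hC : C ≠ 0) {ε : ℝ} (hε : 0 < ε)
    (hm : ⌊1800 * (n * pauliL1 C ^ 2 / ε ^ 2)⌋₊ ≤ m) :
    2 / 3 ≤ ∑ s : Fin m → PauliIndex n with ‖sampleMean C s - C.map Complex.ofReal‖ ≤ ε,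
      ∏ k, ‖pauliCoeff C (s k)‖ / pauliL1 C := by
  have hL := pauliL1_pos hC
  have hn1 : (1 : ℝ) ≤ n := by exact_mod_cast hn
  set W : (Fin m → PauliIndex n) → ℝ := fun s => ∏ k, ‖pauliCoeff C (s k)‖ / pauliL1 C with hW
  have hW0 : ∀ s, 0 ≤ W s := fun s => Finset.prod_nonneg fun k _ => by positivity
  have hW1 : ∑ s, W s = 1 := sum_prod_weight (κ := Fin m)
    (w := fun p => ‖pauliCoeff C p‖ / pauliL1 C)
    (by rw [← Finset.sum_div]; exact div_self hL.ne')
  set x : ℝ := n * pauliL1 C ^ 2 / ε ^ 2 with hx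
  have hlt : 1800 * x < m + 1 := (Nat.lt_floor_add_one _).trans_le (by gcongr)
  have hxε : x * ε ^ 2 = n * pauliL1 C ^ 2 := by rw [hx]; field_simp
  rcases Nat.eq_zero_or_pos m with rfl | hmpos
  -- With no samples the mean is `0`, which is good because the floor vanishes only if
  -- `‖C‖ ≤ ‖C‖_{P,ℓ₁} ≤ ε`.
  · have hle : pauliL1 C ≤ ε := by
      simp only [Nat.cast_zero, zero_add] at hlt
      refine le_of_sq_le_sq ?_ hε.le
      nlinarith [sq_nonneg ε, sq_nonneg (pauliL1 C)]
    rw [Finset.filter_true_of_mem, hW1]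
    · norm_num
    · intro s _
      simpa [sampleMean] using (norm_map_ofReal_le_pauliL1 C).trans hle
  have hm1 : (1 : ℝ) ≤ m := by exact_mod_cast hmpos
  have h := sum_weight_mul_norm_sampleMean_sub_le hn hmpos hC
  have hsq : 30 * Real.sqrt (n * m) * pauliL1 C ≤ m * ε := by
    refine le_of_sq_le_sq ?_ (by positivity)
    rw [mul_pow, mul_pow, Real.sq_sqrt (by positivity)]
    -- `1800 x < m + 1 ≤ 2 m`: the factor `2` pays for rounding down.
    have h900 : 900 * x ≤ m := by linarith
    calc (30 : ℝ) ^ 2 * (n * m) * pauliL1 C ^ 2 = m * ε ^ 2 * (900 * x) := by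
          linear_combination (-900 * (m : ℝ)) * hxε
      _ ≤ m * ε ^ 2 * m := by gcongr
      _ = _ := by ring
  have hmean : ∑ s, W s * ‖sampleMean C s - C.map Complex.ofReal‖ ≤ ε / 3 := by
    refine le_of_mul_le_mul_left ?_ (by linarith : (0 : ℝ) < m)
    linarith
  have hsplit := Finset.sum_filter_add_sum_filter_not Finset.univ
    (fun s => ‖sampleMean C s - C.map Complex.ofReal‖ ≤ ε) W
  rw [hW1] at hsplit
  have hbad : ε * ∑ s with ¬ ‖sampleMean C s - C.map Complex.ofReal‖ ≤ ε, W s ≤ ε / 3 := by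
    rw [Finset.mul_sum]
    refine le_trans ?_ (le_trans (Finset.sum_le_sum_of_subset_of_nonneg (Finset.filter_subset
      (fun s => ¬ ‖sampleMean C s - C.map Complex.ofReal‖ ≤ ε) Finset.univ)
      fun s _ _ => mul_nonneg (hW0 s) (norm_nonneg _)) hmean)
    refine Finset.sum_le_sum fun s hs => ?_
    rw [mul_comm]
    exact mul_le_mul_of_nonneg_left (not_le.1 (Finset.mem_filter.1 hs).2).le (hW0 s)
  have hbad' : ∑ s with ¬ ‖sampleMean C s - C.map Complex.ofReal‖ ≤ ε, W s ≤ 1 / 3 := by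
    refine le_of_mul_le_mul_left ?_ hε
    linarith
  linarith

theorem exists_of_norm_sampleMean_sub_le {n m : ℕ} {C : Matrix (Qubits n) (Qubits n) ℝ} {ε : ℝ}
    {s : Fin m → PauliIndex n} (hs : ‖sampleMean C s - C.map Complex.ofReal‖ ≤ ε) :
    ∃ Ct : Matrix (Qubits n) (Qubits n) ℝ, Ct.map Complex.ofReal = sampleMean C s ∧
      pauliTerms Ct ≤ m ∧ ‖C - Ct‖ ≤ ε := by
  obtain ⟨Ct, hCt⟩ := exists_map_ofReal_eq_sampleMean C s
  refine ⟨Ct, hCt, pauliTerms_le_of_map_eq_sampleMean hCt, (l2_opNorm_le_map_ofReal _).trans ?_⟩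
  have : (C - Ct).map Complex.ofReal = C.map Complex.ofReal - Ct.map Complex.ofReal := by
    ext
    simp
  rw [this, hCt, norm_sub_rev]
  exact hs

theorem measureReal_forall_eq {Ω κ α : Type*} [MeasurableSpace Ω] {μ : Measure Ω}
    [Fintype κ] [MeasurableSpace α] [MeasurableSingletonClass α] {S : κ → Ω → α}
    (hind : iIndepFun S μ) (s : κ → α) :
    μ.real {ω | ∀ k, S k ω = s k} = ∏ k, μ.real {ω | S k ω = s k} := by
  have h := hind.measure_inter_preimage_eq_mul Finset.univ (sets := fun k => {s k})
    (fun k _ => measurableSet_singleton _)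
  simp only [Measure.real, ← ENNReal.toReal_prod]
  congr 1
  have h2 : {ω | ∀ k, S k ω = s k} = ⋂ k ∈ Finset.univ, S k ⁻¹' {s k} := by
    ext ω
    simp
  rw [h2, h]
  rfl

/-- The approximation exists because the sample tuples with a good mean carry positive total weight,
so that there is at least one. -/
theorem exists_pauliTerms_le_norm_sub_le {n : ℕ} (hn : 1 ≤ n) (C : Matrix (Qubits n) (Qubits n) ℝ)
    {ε : ℝ} (hε : 0 < ε) :
    ∃ Ct : Matrix (Qubits n) (Qubits n) ℝ,
      (pauliTerms Ct : ℝ) ≤ 1800 * (n * pauliL1 C ^ 2 / ε ^ 2) ∧ ‖C - Ct‖ ≤ ε := by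
  rcases eq_or_ne C 0 with rfl | hC
  · refine ⟨0, ?_, by simpa using hε.le⟩
    have h0 : pauliTerms (0 : Matrix (Qubits n) (Qubits n) ℝ) = 0 := by
      have hmap : (0 : Matrix (Qubits n) (Qubits n) ℝ).map Complex.ofReal = 0 := by
        ext
        simp
      simp [pauliTerms, pauliCoeff, hmap]
    rw [h0, Nat.cast_zero]
    positivity
  · have h := two_thirds_le_sum_weight hn hC hε le_rfl
    obtain ⟨s, hs, -⟩ := Finset.exists_ne_zero_of_sum_ne_zero
      (show _ ≠ (0 : ℝ) from (lt_of_lt_of_le (by norm_num) h).ne')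
    obtain ⟨Ct, -, hterms, hnorm⟩ :=
      exists_of_norm_sampleMean_sub_le (Finset.mem_filter.1 hs).2
    exact ⟨Ct, (Nat.cast_le.2 hterms).trans (Nat.floor_le (by positivity)), hnorm⟩

/-- Independent samples produce each tuple `s` with probability equal to its product weight, so the
weight estimate for good tuples is a probability estimate. -/
theorem two_thirds_le_measureReal {n m : ℕ} (hn : 1 ≤ n) {C : Matrix (Qubits n) (Qubits n) ℝ}
    (hC : C ≠ 0) {ε : ℝ} (hε : 0 < ε) (hm : ⌊1800 * (n * pauliL1 C ^ 2 / ε ^ 2)⌋₊ ≤ m)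
    {Ω : Type*} [MeasurableSpace Ω] (μ : Measure Ω) [IsProbabilityMeasure μ]
    (S : Fin m → Ω → PauliIndex n) (hS : ∀ k, Measurable (S k)) (hind : iIndepFun S μ)
    (hlaw : ∀ k p, μ.real {ω | S k ω = p} = ‖pauliCoeff C p‖ / pauliL1 C) :
    2 / 3 ≤ μ.real {ω | ∃ Ct : Matrix (Qubits n) (Qubits n) ℝ,
      Ct.map Complex.ofReal = sampleMean C (fun k => S k ω) ∧ pauliTerms Ct ≤ m ∧
        ‖C - Ct‖ ≤ ε} := by
  refine (two_thirds_le_sum_weight hn hC hε hm).trans ?_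
  have hmeas : ∀ s : Fin m → PauliIndex n, MeasurableSet {ω | ∀ k, S k ω = s k} := by
    intro s
    rw [Set.ofPred_forall]
    exact MeasurableSet.iInter fun k => hS k (measurableSet_singleton (s k))
  have hdisj : Pairwise (Function.onFun Disjoint
      fun s : Fin m → PauliIndex n => {ω | ∀ k, S k ω = s k}) := by
    intro s s' hss
    refine Set.disjoint_left.2 fun ω h h' => hss (funext fun k => ?_)
    rw [← h k, h' k]
  calc _ = ∑ s : Fin m → PauliIndex n with ‖sampleMean C s - C.map Complex.ofReal‖ ≤ ε,
        μ.real {ω | ∀ k, S k ω = s k} :=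
        Finset.sum_congr rfl fun s _ => by simp only [measureReal_forall_eq hind, hlaw]
    _ = μ.real (⋃ s ∈ Finset.univ.filter fun s : Fin m → PauliIndex n =>
          ‖sampleMean C s - C.map Complex.ofReal‖ ≤ ε, {ω | ∀ k, S k ω = s k}) :=
        (measureReal_biUnion_finset (hdisj.set_pairwise _) fun s _ => hmeas s).symm
    _ ≤ _ := by
        refine measureReal_mono fun ω hω => ?_
        simp only [Set.mem_iUnion, Finset.mem_filter, Finset.mem_univ, true_and] at hω
        obtain ⟨s, hs, hωs⟩ := hω
        have : (fun k => S k ω) = s := funext hωs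
        exact exists_of_norm_sampleMean_sub_le (this ▸ hs)

end PauliSparsification

theorem mainTheorem5 :
    ∃ K : ℝ, 0 < K ∧
      ∀ (n : ℕ), 1 ≤ n →
      ∀ (C : Matrix (PauliSparsification.Qubits n) (PauliSparsification.Qubits n) ℝ)
        (ε : ℝ), 0 < ε →
        (∃ Ct : Matrix (PauliSparsification.Qubits n) (PauliSparsification.Qubits n) ℝ,
          (PauliSparsification.pauliTerms Ct : ℝ) ≤
              K * (n * PauliSparsification.pauliL1 C ^ 2 / ε ^ 2) ∧
            ‖C - Ct‖ ≤ ε) ∧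
        (C ≠ 0 →
          ∀ (m : ℕ), ⌊K * (n * PauliSparsification.pauliL1 C ^ 2 / ε ^ 2)⌋₊ ≤ m →
          ∀ (Ω : Type*) [MeasurableSpace Ω] (μ : Measure Ω) [IsProbabilityMeasure μ]
            (S : Fin m → Ω → PauliSparsification.PauliIndex n),
            (∀ k, Measurable (S k)) →
            iIndepFun S μ →
            (∀ k p, μ.real {ω | S k ω = p} =
              ‖PauliSparsification.pauliCoeff C p‖ / PauliSparsification.pauliL1 C) →
            2 / 3 ≤ μ.real {ω |
              ∃ Ct : Matrix (PauliSparsification.Qubits n) (PauliSparsification.Qubits n) ℝ,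
                Ct.map Complex.ofReal =
                    PauliSparsification.sampleMean C (fun k => S k ω) ∧
                  PauliSparsification.pauliTerms Ct ≤ m ∧
                  ‖C - Ct‖ ≤ ε}) := by
  refine ⟨1800, by norm_num, fun n hn C ε hε => ⟨?_, ?_⟩⟩
  · exact PauliSparsification.exists_pauliTerms_le_norm_sub_le hn C hε
  · intro hC m hm Ω _ μ _ S hS hind hlaw
    exact PauliSparsification.two_thirds_le_measureReal hn hC hε hm μ S hS hind hlaw
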